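/- Let $n\ge 2$, work over $\mathbb C$. For an $n\times n$ matrix $M$ let $\mathrm{Rig}_r(M)$ be the least $s$ such that $M=A+B$ with $\operatorname{rank}A\le r$ and $B$ having exactly $s$ nonzero entries, and let $\hat{\mathcal R}[n,r,s]$ be the Zariski closure, in the space of $n\times n$ matrices, of $\{M : \mathrm{Rig}_r(M)\le s\}$. Call $M$ maximally $r$-rigid if $\mathrm{Rig}_r(M)=(n-r)^2$, and maximally $r$-border rigid if $M\notin\hat{\mathcal R}[n,r,(n-r)^2-1]$. Write $\Delta^I_J(M)$ for the determinant of the matrix obtained from $M$ by deleting the rows in $I$ and the columns in $J$, where $I,J\subset\{1,\dots,n\}$ with $|I|=|J|$, the remaining rows and columns being kept in increasing order. Proposition. A general Cauchy matrix is maximally $1$-rigid and maximally $1$-border rigid, and also maximally $(n-2)$-rigid and maximally $(n-2)$-border rigid. Precisely: there is a nonzero polynomial $F$ in the $2n$ variables $x^1,\dots,x^n,z_1,\dots,z_n$ such that for every $(x,z)\in\mathbb C^{n}\times\mathbb C^n$ with $F(x,z)\ne0$ all $x^i+z_j$ are nonzero, the Cauchy matrix $Y=(y^i_j)$, $y^i_j=1/(x^i+z_j)$,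 is maximally $r$-rigid and maximally $r$-border rigid for $r=1$ and for $r=n-2$, and $Y$ satisfies none of the hypersurface equations for these two values of $r$: (a) for all $k$, all distinct $i_1,\dots,i_k$, all distinct $j_1,\dots,j_k$ in $\{1,\dots,n\}$ and every $k$-cycle $\sigma\in\mathfrak S_k$ (so $k\ge2$), $$y^{i_1}_{j_1}\cdots y^{i_k}_{j_k}-y^{i_1}_{j_{\sigma(1)}}\cdots y^{i_k}_{j_{\sigma(k)}}\ne0;$$ (b) every minor of $Y$ of size $n-1$ is nonzero, and for all distinct $i_1,i_2,i_3$ and all distinct $j_1,j_2,j_3$ in $\{1,\dots,n\}$, $$\Delta^{\{i_1\}}_{\{j_1\}}(Y)\,\Delta^{\{i_2,i_3\}}_{\{j_2,j_3\}}(Y)-\Delta^{\{i_2\}}_{\{j_2\}}(Y)\,\Delta^{\{i_1,i_3\}}_{\{j_1,j_3\}}(Y)\ne0.$$ -/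

import Mathlib

namespace MatrixRigidity

/-- The `r`-rigidity of `M`: the least `s` such that `M = A + B` with `A` of rank at most `r` and
`B` having exactly `s` nonzero entries. (The set is nonempty: take `A = 0`.) -/
noncomputable def rigidity {n : ℕ} (r : ℕ) (M : Matrix (Fin n) (Fin n) ℂ) : ℕ :=
  sInf {s | ∃ A B : Matrix (Fin n) (Fin n) ℂ, M = A + B ∧ A.rank ≤ r ∧
    {p : Fin n × Fin n | B p.1 p.2 ≠ 0}.ncard = s}

/-- The entries of a matrix, as a point of affine space with coordinates indexed by positions. -/
def entries {n : ℕ} (M : Matrix (Fin n) (Fin n) ℂ) : Fin n × Fin n → ℂ :=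
  fun p => M p.1 p.2

/-- The Zariski closure of a set of matrices: the common zeros of all polynomials in the entries
that vanish on the set. -/
def zariskiClosure {n : ℕ} (X : Set (Matrix (Fin n) (Fin n) ℂ)) :
    Set (Matrix (Fin n) (Fin n) ℂ) :=
  {M | entries M ∈ MvPolynomial.zeroLocus ℂ (MvPolynomial.vanishingIdeal ℂ (entries '' X))}

/-- The matrices of `r`-rigidity at most `s`. -/
def rigidityLocus (n r s : ℕ) : Set (Matrix (Fin n) (Fin n) ℂ) :=
  {M | rigidity r M ≤ s}

/-- The variety of matrices of `r`-border rigidity at most `s`. -/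
def borderRigidityVariety (n r s : ℕ) : Set (Matrix (Fin n) (Fin n) ℂ) :=
  zariskiClosure (rigidityLocus n r s)

/-- `M` is maximally `r`-rigid. -/
def IsMaximallyRigid {n : ℕ} (r : ℕ) (M : Matrix (Fin n) (Fin n) ℂ) : Prop :=
  rigidity r M = (n - r) ^ 2

/-- `M` is maximally `r`-border rigid (a notion for `r < n`, so that `(n - r) ^ 2 - 1` is
a true subtraction). -/
def IsMaximallyBorderRigid {n : ℕ} (r : ℕ) (M : Matrix (Fin n) (Fin n) ℂ) : Prop :=
  M ∉ borderRigidityVariety n r ((n - r) ^ 2 - 1)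

/-- The Cauchy matrix with entries `1 / (x i + z j)`. -/
noncomputable def cauchy {n : ℕ} (x z : Fin n → ℂ) : Matrix (Fin n) (Fin n) ℂ :=
  Matrix.of fun i j => 1 / (x i + z j)

/-- `complMinor M I J` is the determinant of the submatrix of `M` obtained by deleting the rows in
`I` and the columns in `J` (remaining rows and columns in increasing order); it is only used when
`I` and `J` have the same size. -/
noncomputable def complMinor {n : ℕ} (M : Matrix (Fin n) (Fin n) ℂ) (I J : Finset (Fin n)) : ℂ :=
  if h : Jᶜ.card = Iᶜ.card then
    (M.submatrix (Iᶜ.orderEmbOfFin rfl) (Jᶜ.orderEmbOfFin h)).det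
  else 0

end MatrixRigidity

/-! Border rigidity is proved by exhibiting one polynomial that vanishes on the whole rigidity locus
but not at a general Cauchy matrix. Since the locus lies in its closure, this also gives the lower
bound for rigidity; the upper bound `rigidity_le_of_det_ne_zero` needs only an invertible `r × r`
submatrix.

For `r = 1`, a matrix in the locus agrees with some `u i * w j` on at least `2n` positions. These
carry a nonzero integer weighting with zero row and column sums (`exists_isBalanced`), whose
binomial vanishes on rank one matrices. The polynomial is the product of such binomials over all
sets of positions.

For `r = n - 2`, at most three entries change. Either one row and one column cover them, and an `(n
- 1)`-minor vanishes, or they lie in distinct rows and columns, and `complMinor_relation` holds.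
Minors enter squared, so no signs are tracked.

For Cauchy matrices, inverting entries turns binomials into binomials in the `x i + z j`, and
`det_cauchy_succ` makes minors explicit. Each condition becomes the nonvanishing of a polynomial,
checked at one point; there are finitely many, and `F` is a product of the resulting polynomials. -/

namespace MatrixRigidity

open Matrix

/-! ### Polynomial functions and generic properties -/

/-- The ring of polynomial functions on `ι → ℂ`. -/
noncomputable def polynomialFunctions (ι : Type*) : Subring ((ι → ℂ) → ℂ) :=
  (RingHom.pi fun v : ι → ℂ => MvPolynomial.eval v).range

theorem mem_polynomialFunctions {ι : Type*} {f : (ι → ℂ) → ℂ} :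
    f ∈ polynomialFunctions ι ↔ ∃ p : MvPolynomial ι ℂ, ∀ v, MvPolynomial.eval v p = f v := by
  simp only [polynomialFunctions, RingHom.mem_range, funext_iff]
  rfl

theorem coordinate_mem {ι : Type*} (a : ι) :
    (fun v : ι → ℂ => v a) ∈ polynomialFunctions ι :=
  mem_polynomialFunctions.2 ⟨MvPolynomial.X a, by simp⟩

theorem fun_prod_mem {ι κ : Type*} (s : Finset κ) {f : κ → (ι → ℂ) → ℂ}
    (h : ∀ k ∈ s, f k ∈ polynomialFunctions ι) :
    (fun v => ∏ k ∈ s, f k v) ∈ polynomialFunctions ι := by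
  have := prod_mem h
  rwa [show (∏ k ∈ s, f k) = fun v => ∏ k ∈ s, f k v from by ext; simp] at this

theorem fun_add_mem {ι : Type*} {f g : (ι → ℂ) → ℂ} (hf : f ∈ polynomialFunctions ι)
    (hg : g ∈ polynomialFunctions ι) : (fun v => f v + g v) ∈ polynomialFunctions ι :=
  add_mem hf hg

theorem fun_sub_mem {ι : Type*} {f g : (ι → ℂ) → ℂ} (hf : f ∈ polynomialFunctions ι)
    (hg : g ∈ polynomialFunctions ι) : (fun v => f v - g v) ∈ polynomialFunctions ι :=
  sub_mem hf hg

theorem fun_mul_mem {ι : Type*} {f g : (ι → ℂ) → ℂ} (hf : f ∈ polynomialFunctions ι)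
    (hg : g ∈ polynomialFunctions ι) : (fun v => f v * g v) ∈ polynomialFunctions ι :=
  mul_mem hf hg

theorem fun_pow_mem {ι : Type*} {f : (ι → ℂ) → ℂ} (hf : f ∈ polynomialFunctions ι) (k : ℕ) :
    (fun v => f v ^ k) ∈ polynomialFunctions ι :=
  pow_mem hf k

theorem fun_det_mem {ι : Type*} {m : ℕ} {f : (ι → ℂ) → Matrix (Fin m) (Fin m) ℂ}
    (h : ∀ i j, (fun v => f v i j) ∈ polynomialFunctions ι) :
    (fun v => (f v).det) ∈ polynomialFunctions ι := by
  have : (fun v => (f v).det) = ∑ σ : Equiv.Perm (Fin m),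
      (Equiv.Perm.sign σ : ℤ) • (fun v => ∏ i, f v (σ i) i) := by
    ext v
    simp [det_apply, Units.smul_def]
  rw [this]
  exact sum_mem fun σ _ => zsmul_mem (fun_prod_mem _ fun i _ => h _ _) _

/-- A property of points of `ι → ℂ` holds generically if it holds off a hypersurface. -/
def HoldsGenerically {ι : Type*} (P : (ι → ℂ) → Prop) : Prop :=
  ∃ F : MvPolynomial ι ℂ, F ≠ 0 ∧ ∀ v, MvPolynomial.eval v F ≠ 0 → P v

theorem HoldsGenerically.and {ι : Type*} {P Q : (ι → ℂ) → Prop} (hP : HoldsGenerically P)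
    (hQ : HoldsGenerically Q) : HoldsGenerically fun v => P v ∧ Q v := by
  obtain ⟨F, hF, hFP⟩ := hP
  obtain ⟨G, hG, hGQ⟩ := hQ
  refine ⟨F * G, mul_ne_zero hF hG, fun v hv => ?_⟩
  rw [map_mul] at hv
  exact ⟨hFP v (left_ne_zero_of_mul hv), hGQ v (right_ne_zero_of_mul hv)⟩

theorem HoldsGenerically.forall {ι κ : Type*} [Finite κ] {P : κ → (ι → ℂ) → Prop}
    (h : ∀ k, HoldsGenerically (P k)) : HoldsGenerically fun v => ∀ k, P k v := by
  have := Fintype.ofFinite κ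
  choose F hF hP using h
  refine ⟨∏ k, F k, Finset.prod_ne_zero_iff.2 fun k _ => hF k, fun v hv k => hP k v ?_⟩
  rw [map_prod] at hv
  exact Finset.prod_ne_zero_iff.1 hv k (Finset.mem_univ k)

theorem holdsGenerically_ne_zero {ι : Type*} {f : (ι → ℂ) → ℂ} (hf : f ∈ polynomialFunctions ι)
    (v₀ : ι → ℂ) (h : f v₀ ≠ 0) : HoldsGenerically fun v => f v ≠ 0 := by
  obtain ⟨p, hp⟩ := mem_polynomialFunctions.1 hf
  refine ⟨p, ?_, fun v hv => (hp v).symm.trans_ne hv⟩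
  rintro rfl
  exact h (by simp [← hp])

/-! ### Rigidity and its closure -/

theorem notMem_zariskiClosure {n : ℕ} {X : Set (Matrix (Fin n) (Fin n) ℂ)}
    {Y : Matrix (Fin n) (Fin n) ℂ} {f : (Fin n × Fin n → ℂ) → ℂ}
    (hf : f ∈ polynomialFunctions (Fin n × Fin n)) (hX : ∀ M ∈ X, f (entries M) = 0)
    (hY : f (entries Y) ≠ 0) : Y ∉ zariskiClosure X := by
  obtain ⟨p, hp⟩ := mem_polynomialFunctions.1 hf
  intro h
  refine hY ?_
  have h2 : p ∈ MvPolynomial.vanishingIdeal ℂ (entries '' X) := by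
    rw [MvPolynomial.mem_vanishingIdeal_iff]
    rintro _ ⟨M, hM, rfl⟩
    rw [MvPolynomial.aeval_eq_eval, hp, hX M hM]
  have h3 := MvPolynomial.mem_zeroLocus_iff.1 h p h2
  rwa [MvPolynomial.aeval_eq_eval, hp] at h3

theorem exists_of_rigidity_le {n r s : ℕ} {M : Matrix (Fin n) (Fin n) ℂ} (h : rigidity r M ≤ s) :
    ∃ A : Matrix (Fin n) (Fin n) ℂ, A.rank ≤ r ∧
      {p : Fin n × Fin n | M p.1 p.2 ≠ A p.1 p.2}.ncard ≤ s := by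
  -- Nonemptiness makes the infimum attained; `sInf ∅ = 0` would give no decomposition.
  have hne : {s | ∃ A B : Matrix (Fin n) (Fin n) ℂ, M = A + B ∧ A.rank ≤ r ∧
      {p : Fin n × Fin n | B p.1 p.2 ≠ 0}.ncard = s}.Nonempty :=
    ⟨_, 0, M, by simp, by simp, rfl⟩
  obtain ⟨A, B, rfl, hA, hB⟩ := Nat.sInf_mem hne
  refine ⟨A, hA, ?_⟩
  simpa [rigidity] using hB.trans_le h

theorem rigidity_le {n r s : ℕ} {M A : Matrix (Fin n) (Fin n) ℂ} (hA : A.rank ≤ r)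
    (h : {p : Fin n × Fin n | M p.1 p.2 ≠ A p.1 p.2}.ncard ≤ s) : rigidity r M ≤ s := by
  have hmem : {p : Fin n × Fin n | M p.1 p.2 ≠ A p.1 p.2}.ncard ∈
      {s | ∃ A B : Matrix (Fin n) (Fin n) ℂ, M = A + B ∧ A.rank ≤ r ∧
        {p : Fin n × Fin n | B p.1 p.2 ≠ 0}.ncard = s} :=
    ⟨A, M - A, by simp, hA, by simp [sub_eq_zero]⟩
  exact (Nat.sInf_le hmem).trans h

/-- The skeleton `C * D⁻¹ * R`, built from the columns `C` and rows `R` through the invertible block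
`D`, has rank at most `r` and reproduces those rows and columns. Only the complementary block can
differ. -/
theorem rigidity_le_of_det_ne_zero {n r : ℕ} {M : Matrix (Fin n) (Fin n) ℂ} (e f : Fin r ↪ Fin n)
    (h : (M.submatrix e f).det ≠ 0) : rigidity r M ≤ (n - r) ^ 2 := by
  set D := M.submatrix e f with hD
  have hu : IsUnit D.det := h.isUnit
  let A := M.submatrix id f * (D⁻¹ * M.submatrix e id)
  have hrow : ∀ a q, A (e a) q = M (e a) q := by
    intro a q
    have : (D * (D⁻¹ * M.submatrix e id)) a q = M (e a) q := by
      rw [← Matrix.mul_assoc, Matrix.mul_nonsing_inv _ hu, Matrix.one_mul]; rfl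
    rw [← this]; rfl
  have hcol : ∀ p b, A p (f b) = M p (f b) := by
    intro p b
    have : ((M.submatrix id f * D⁻¹) * D) p b = M p (f b) := by
      rw [Matrix.mul_assoc, Matrix.nonsing_inv_mul _ hu, Matrix.mul_one]; rfl
    rw [← this, Matrix.mul_assoc]; rfl
  refine rigidity_le (A := A)
    ((rank_mul_le_left _ _).trans ((rank_le_card_width _).trans (by simp))) ?_
  have hsub : {p : Fin n × Fin n | M p.1 p.2 ≠ A p.1 p.2} ⊆
      (((Finset.univ.map e)ᶜ ×ˢ (Finset.univ.map f)ᶜ : Finset (Fin n × Fin n)) :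
        Set (Fin n × Fin n)) := by
    rintro ⟨p, q⟩ hp
    simp only [Finset.coe_product, Set.mem_prod, Finset.mem_coe, Finset.mem_compl,
      Finset.mem_map, Finset.mem_univ, true_and]
    constructor
    · rintro ⟨a, rfl⟩
      exact hp (hrow a q).symm
    · rintro ⟨b, rfl⟩
      exact hp (hcol p b).symm
  refine (Set.ncard_le_ncard hsub (Finset.finite_toSet _)).trans ?_
  rw [Set.ncard_coe_finset, Finset.card_product]
  simp [Finset.card_compl, sq]

theorem isMaximallyRigid_of_borderRigid {n r : ℕ} {M : Matrix (Fin n) (Fin n) ℂ}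
    (hb : IsMaximallyBorderRigid r M) (h : rigidity r M ≤ (n - r) ^ 2) :
    IsMaximallyRigid r M := by
  refine le_antisymm h ?_
  by_contra hlt
  refine hb ?_
  have hM : M ∈ rigidityLocus n r ((n - r) ^ 2 - 1) := by
    change rigidity r M ≤ _
    -- `hlt` forces `(n - r) ^ 2` to be positive, so the subtraction is not truncated.
    omega
  change _ ∈ MvPolynomial.zeroLocus _ _
  rw [MvPolynomial.mem_zeroLocus_iff]
  exact fun p hp => hp _ ⟨M, hM, rfl⟩

/-! ### Minors -/

/-- Two enumerations of the same set differ by a permutation, whose sign disappears on squaring.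
Rows and columns may thus be listed in any convenient order. -/
theorem complMinor_sq {n m : ℕ} (M : Matrix (Fin n) (Fin n) ℂ) {I J : Finset (Fin n)}
    {e f : Fin m → Fin n} (he : Function.Injective e) (hf : Function.Injective f)
    (hI : ∀ i, i ∈ Set.range e ↔ i ∉ I) (hJ : ∀ j, j ∈ Set.range f ↔ j ∉ J) :
    complMinor M I J ^ 2 = (M.submatrix e f).det ^ 2 := by
  have key : ∀ {K : Finset (Fin n)} {g : Fin m → Fin n}, Function.Injective g →
      (∀ i, i ∈ Set.range g ↔ i ∉ K) → ∃ h : Kᶜ.card = m, ∃ σ : Equiv.Perm (Fin m),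
        g = Kᶜ.orderEmbOfFin h ∘ σ := by
    intro K g hg hK
    have hc : Kᶜ = Finset.univ.image g := by
      ext i
      have := hK i
      simp only [Set.mem_range] at this
      simp [this]
    have h : Kᶜ.card = m := by
      rw [hc, Finset.card_image_of_injective _ hg, Finset.card_univ, Fintype.card_fin]
    have hmem : ∀ a, ∃ b, Kᶜ.orderEmbOfFin h b = g a := by
      intro a
      have : g a ∈ Set.range (Kᶜ.orderEmbOfFin h) := by
        rw [Finset.range_orderEmbOfFin, hc]; simp
      exact this
    choose s hs using hmem
    have hsi : Function.Injective s := fun a b hab => hg (by rw [← hs, ← hs, hab])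
    exact ⟨h, Equiv.ofBijective s (Finite.injective_iff_bijective.1 hsi),
      funext fun a => (hs a).symm⟩
  obtain ⟨h1, σ, rfl⟩ := key he hI
  obtain ⟨h2, τ, rfl⟩ := key hf hJ
  subst h1
  rw [complMinor, dif_pos h2]
  have : M.submatrix (Iᶜ.orderEmbOfFin rfl ∘ σ) (Jᶜ.orderEmbOfFin h2 ∘ τ) =
      ((M.submatrix (Iᶜ.orderEmbOfFin rfl) (Jᶜ.orderEmbOfFin h2)).submatrix σ id).submatrix
        id τ := rfl
  rw [this, det_permute', det_permute, mul_pow, mul_pow]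
  rcases Int.units_eq_one_or (Equiv.Perm.sign σ) with h | h <;>
    rcases Int.units_eq_one_or (Equiv.Perm.sign τ) with h' | h' <;> simp [h, h']

theorem complMinor_mem_polynomialFunctions {n : ℕ} (I J : Finset (Fin n)) :
    (fun v : Fin n × Fin n → ℂ => complMinor (of fun i j => v (i, j)) I J) ∈
      polynomialFunctions (Fin n × Fin n) := by
  by_cases h : Jᶜ.card = Iᶜ.card
  · simp only [complMinor, dif_pos h]
    exact fun_det_mem fun i j => coordinate_mem _
  · simp only [complMinor, dif_neg h]
    exact zero_mem _

theorem exists_enumeration_compl {n m : ℕ} (I : Finset (Fin n)) (h : I.card + m = n) :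
    ∃ e : Fin m → Fin n, Function.Injective e ∧ ∀ i, i ∈ Set.range e ↔ i ∉ I := by
  have hc : Iᶜ.card = m := by rw [Finset.card_compl, Fintype.card_fin]; omega
  refine ⟨Iᶜ.orderEmbOfFin hc, (Iᶜ.orderEmbOfFin hc).injective, fun i => ?_⟩
  rw [Finset.range_orderEmbOfFin]; simp

theorem cons_enumerates {n m : ℕ} {I I' : Finset (Fin n)} {e : Fin m → Fin n} {a : Fin n}
    (he : Function.Injective e) (hI : ∀ i, i ∈ Set.range e ↔ i ∉ I) (ha : a ∈ I)
    (hI' : I' = I.erase a) :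
    Function.Injective (Fin.cons a e : Fin (m + 1) → Fin n) ∧
      ∀ i, i ∈ Set.range (Fin.cons a e : Fin (m + 1) → Fin n) ↔ i ∉ I' := by
  subst hI'
  refine ⟨Fin.cons_injective_iff.2 ⟨fun h => (hI a).1 h ha, he⟩, fun i => ?_⟩
  rw [Fin.range_cons, Set.mem_insert_iff, hI, Finset.mem_erase]
  tauto

theorem det_submatrix_eq_zero {n m : ℕ} {A : Matrix (Fin n) (Fin n) ℂ} (h : A.rank < m)
    (e f : Fin m → Fin n) : (A.submatrix e f).det = 0 := by
  by_contra hne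
  have h1 := rank_of_isUnit (A.submatrix e f) ((isUnit_iff_isUnit_det _).2 (Ne.isUnit hne))
  have h2 := rank_submatrix_le A e f
  rw [Fintype.card_fin] at h1
  omega

theorem complMinor_eq_zero {n : ℕ} (hn : 2 ≤ n) {M A : Matrix (Fin n) (Fin n) ℂ}
    (hA : A.rank ≤ n - 2) {a b : Fin n} (h : ∀ p q, p ≠ a → q ≠ b → M p q = A p q) :
    complMinor M {a} {b} = 0 := by
  obtain ⟨e, he, he'⟩ := exists_enumeration_compl (m := n - 1) {a} (by simp; omega)
  obtain ⟨f, hf, hf'⟩ := exists_enumeration_compl (m := n - 1) {b} (by simp; omega)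
  have h1 := complMinor_sq M he hf he' hf'
  have h2 : M.submatrix e f = A.submatrix e f := by
    ext i j
    exact h _ _ (by simpa using (he' (e i)).1 ⟨i, rfl⟩) (by simpa using (hf' (f j)).1 ⟨j, rfl⟩)
  rw [h2, det_submatrix_eq_zero (by omega)] at h1
  simpa using h1

/-- The determinant is affine in its corner entry, with the corner cofactor as slope. -/
theorem det_sub_det_of_eq_off_zero {m : ℕ} {M N : Matrix (Fin (m + 1)) (Fin (m + 1)) ℂ}
    (h : ∀ i j, (i ≠ 0 ∨ j ≠ 0) → M i j = N i j) :
    M.det - N.det = (M 0 0 - N 0 0) * (M.submatrix Fin.succ Fin.succ).det := by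
  have hs : ∀ j : Fin (m + 1), N.submatrix Fin.succ j.succAbove =
      M.submatrix Fin.succ j.succAbove := by
    intro j
    ext a b
    exact (h _ _ (Or.inl (Fin.succ_ne_zero a))).symm
  rw [det_succ_row_zero M, det_succ_row_zero N, Fin.sum_univ_succ, Fin.sum_univ_succ]
  simp only [hs]
  rw [Finset.sum_congr rfl fun j _ => by rw [h 0 (Fin.succ j) (Or.inr (Fin.succ_ne_zero j))]]
  simp only [Fin.succAbove_zero, Fin.val_zero, pow_zero]
  ring

/-- The corresponding `(n - 1)`-minor of `A` is zero by rank, and only the entry `(c, d)` can differ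
inside it. Listing `c` and `d` first makes this the corner entry. -/
theorem complMinor_sq_eq_mul_sq {n : ℕ} (hn : 2 ≤ n) {M A : Matrix (Fin n) (Fin n) ℂ}
    (hA : A.rank ≤ n - 2) {a b c d : Fin n} (hac : a ≠ c) (hbd : b ≠ d)
    (h : ∀ p q, p ≠ a → q ≠ b → (p ≠ c ∨ q ≠ d) → M p q = A p q) :
    complMinor M {a} {b} ^ 2 = (M c d - A c d) ^ 2 * complMinor M {a, c} {b, d} ^ 2 := by
  obtain ⟨e, he, he'⟩ := exists_enumeration_compl (m := n - 2) {a, c}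
    (by rw [Finset.card_pair hac]; omega)
  obtain ⟨f, hf, hf'⟩ := exists_enumeration_compl (m := n - 2) {b, d}
    (by rw [Finset.card_pair hbd]; omega)
  obtain ⟨he2, he2'⟩ := cons_enumerates (I' := {a}) (a := c) he he' (by simp)
    (by ext i; simp; grind)
  obtain ⟨hf2, hf2'⟩ := cons_enumerates (I' := {b}) (a := d) hf hf' (by simp)
    (by ext i; simp; grind)
  rw [complMinor_sq M he hf he' hf', complMinor_sq M he2 hf2 he2' hf2', ← mul_pow]
  have := det_sub_det_of_eq_off_zero (M := M.submatrix (Fin.cons c e) (Fin.cons d f))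
    (N := A.submatrix (Fin.cons c e) (Fin.cons d f)) (by
      intro i j hij
      refine h _ _ (by simpa using (he2' _).1 ⟨i, rfl⟩) (by simpa using (hf2' _).1 ⟨j, rfl⟩) ?_
      refine hij.imp (fun hi hc => hi (he2 ?_)) (fun hj hd => hj (hf2 ?_))
      · rw [hc, Fin.cons_zero]
      · rw [hd, Fin.cons_zero])
  rw [det_submatrix_eq_zero (A := A) (by omega), sub_zero] at this
  rw [this]
  rfl

/-- Deleting row `i 0` and column `j 0`, or row `i 1` and column `j 1`, removes the first two
changed positions. Both minors are then governed by the same change at `(i 2, j 2)`, which is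
eliminated. -/
theorem complMinor_relation {n : ℕ} (hn : 2 ≤ n) {M A : Matrix (Fin n) (Fin n) ℂ}
    (hA : A.rank ≤ n - 2) (i j : Fin 3 ↪ Fin n)
    (h : ∀ p q, M p q ≠ A p q →
      (p = i 0 ∧ q = j 1) ∨ (p = i 1 ∧ q = j 0) ∨ (p = i 2 ∧ q = j 2)) :
    (complMinor M {i 0} {j 0} * complMinor M {i 1, i 2} {j 1, j 2}) ^ 2
      - (complMinor M {i 1} {j 1} * complMinor M {i 0, i 2} {j 0, j 2}) ^ 2 = 0 := by
  have hi : ∀ {a b : Fin 3}, a ≠ b → i a ≠ i b := fun hab h => hab (i.injective h)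
  have hj : ∀ {a b : Fin 3}, a ≠ b → j a ≠ j b := fun hab h => hab (j.injective h)
  rw [mul_pow, mul_pow,
    complMinor_sq_eq_mul_sq hn hA (a := i 0) (b := j 0) (c := i 2) (d := j 2) (hi (by decide))
      (hj (by decide)) (by intro p q h1 h2 h3; by_contra h4; have := h p q h4; tauto),
    complMinor_sq_eq_mul_sq hn hA (a := i 1) (b := j 1) (c := i 2) (d := j 2) (hi (by decide))
      (hj (by decide)) (by intro p q h1 h2 h3; by_contra h4; have := h p q h4; tauto)]
  ring

/-- After padding to three positions: if two share a line, that line and a perpendicular one through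
the third cover everything. -/
theorem exists_cover_or_transversal {n : ℕ} {S : Set (Fin n × Fin n)} (hn : 2 ≤ n)
    (hS : S.ncard ≤ 3) :
    (∃ a b : Fin n, ∀ p ∈ S, p.1 = a ∨ p.2 = b) ∨
    ∃ i j : Fin 3 ↪ Fin n, ∀ p ∈ S,
      (p.1 = i 0 ∧ p.2 = j 1) ∨ (p.1 = i 1 ∧ p.2 = j 0) ∨ (p.1 = i 2 ∧ p.2 = j 2) := by
  classical
  have h3 : 3 ≤ (Finset.univ : Finset (Fin n × Fin n)).card := by
    rw [Finset.card_univ, Fintype.card_prod, Fintype.card_fin]; nlinarith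
  obtain ⟨T, hST, -, hT⟩ := Finset.exists_subsuperset_card_eq (Finset.subset_univ S.toFinset)
    (by rwa [← Set.ncard_eq_toFinset_card']) h3
  obtain ⟨p, q, r, -, -, -, rfl⟩ := Finset.card_eq_three.1 hT
  have hmem : ∀ x ∈ S, x = p ∨ x = q ∨ x = r := fun x hx => by
    simpa using hST (Set.mem_toFinset.2 hx)
  by_cases h1 : p.1 = q.1
  · exact Or.inl ⟨p.1, r.2, by grind⟩
  by_cases h2 : p.1 = r.1
  · exact Or.inl ⟨p.1, q.2, by grind⟩
  by_cases h3 : q.1 = r.1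
  · exact Or.inl ⟨q.1, p.2, by grind⟩
  by_cases h4 : p.2 = q.2
  · exact Or.inl ⟨r.1, p.2, by grind⟩
  by_cases h5 : p.2 = r.2
  · exact Or.inl ⟨q.1, p.2, by grind⟩
  by_cases h6 : q.2 = r.2
  · exact Or.inl ⟨p.1, q.2, by grind⟩
  -- The first two columns are swapped, to match the positions `(i 0, j 1)` and `(i 1, j 0)`.
  refine Or.inr ⟨⟨![p.1, q.1, r.1], ?_⟩, ⟨![q.2, p.2, r.2], ?_⟩, fun x hx => ?_⟩
  · simp only [Function.Injective, Fin.forall_fin_succ]; simp; grind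
  · simp only [Function.Injective, Fin.forall_fin_succ]; simp; grind
  · have := hmem x hx
    simp only [Function.Embedding.coeFn_mk, Matrix.cons_val]
    grind

theorem isMaximallyBorderRigid_sub_two {n : ℕ} (hn : 2 ≤ n) {Y : Matrix (Fin n) (Fin n) ℂ}
    (h1 : ∀ i j, complMinor Y {i} {j} ≠ 0)
    (h2 : ∀ i j : Fin 3 ↪ Fin n,
      (complMinor Y {i 0} {j 0} * complMinor Y {i 1, i 2} {j 1, j 2}) ^ 2
      - (complMinor Y {i 1} {j 1} * complMinor Y {i 0, i 2} {j 0, j 2}) ^ 2 ≠ 0) :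
    IsMaximallyBorderRigid (n - 2) Y := by
  let N : (Fin n × Fin n → ℂ) → Matrix (Fin n) (Fin n) ℂ := fun v => of fun i j => v (i, j)
  refine notMem_zariskiClosure (f := fun v =>
    (∏ p : Fin n × Fin n, complMinor (N v) {p.1} {p.2}) *
    ∏ p : (Fin 3 ↪ Fin n) × (Fin 3 ↪ Fin n),
      ((complMinor (N v) {p.1 0} {p.2 0} * complMinor (N v) {p.1 1, p.1 2} {p.2 1, p.2 2}) ^ 2
      - (complMinor (N v) {p.1 1} {p.2 1} * complMinor (N v) {p.1 0, p.1 2} {p.2 0, p.2 2}) ^ 2))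
    ?_ ?_ ?_
  · refine fun_mul_mem (fun_prod_mem _ fun p _ => complMinor_mem_polynomialFunctions _ _)
      (fun_prod_mem _ fun p _ => fun_sub_mem (fun_pow_mem (fun_mul_mem ?_ ?_) _)
        (fun_pow_mem (fun_mul_mem ?_ ?_) _)) <;>
    exact complMinor_mem_polynomialFunctions _ _
  · intro M hM
    obtain ⟨A, hA, hS⟩ := exists_of_rigidity_le hM
    have h3 : (n - (n - 2)) ^ 2 - 1 = 3 := by
      rw [show n - (n - 2) = 2 by omega]; norm_num
    rw [h3] at hS
    change (∏ p : Fin n × Fin n, complMinor M {p.1} {p.2}) *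
      ∏ p : (Fin 3 ↪ Fin n) × (Fin 3 ↪ Fin n), (_ - _) = 0
    rcases exists_cover_or_transversal hn hS with ⟨a, b, hab⟩ | ⟨i, j, hij⟩
    · refine mul_eq_zero_of_left (Finset.prod_eq_zero (Finset.mem_univ (a, b)) ?_) _
      refine complMinor_eq_zero hn hA fun p q hp hq => ?_
      by_contra hne
      exact (hab (p, q) hne).elim hp hq
    · refine mul_eq_zero_of_right _ (Finset.prod_eq_zero (Finset.mem_univ (i, j)) ?_)
      exact complMinor_relation hn hA i j fun p q hpq => hij (p, q) hpq
  · exact mul_ne_zero (Finset.prod_ne_zero_iff.2 fun p _ => h1 _ _)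
      (Finset.prod_ne_zero_iff.2 fun p _ => h2 _ _)

/-! ### Balanced exponents and rank one matrices -/

/-- An integer weighting of the positions whose row sums and column sums vanish. -/
def IsBalanced {n : ℕ} (c : Fin n × Fin n → ℤ) : Prop :=
  (∀ i, ∑ j, c (i, j) = 0) ∧ ∀ j, ∑ i, c (i, j) = 0

/-- The row and column sums have the same total, so one column condition is redundant. There remain
`2n - 1` integer linear equations in at least `2n` unknowns; Siegel's lemma solves them, its bound
being irrelevant. -/
theorem exists_isBalanced {n : ℕ} (hn : 0 < n) (E : Finset (Fin n × Fin n))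
    (hE : 2 * n ≤ E.card) :
    ∃ c : Fin n × Fin n → ℤ, c ≠ 0 ∧ (∀ p, p ∉ E → c p = 0) ∧ IsBalanced c := by
  let j₀ : Fin n := ⟨0, hn⟩
  let A : Matrix (Fin n ⊕ {j : Fin n // j ≠ j₀}) E ℤ := of fun a e =>
    Sum.elim (fun i => if e.1.1 = i then 1 else 0) (fun j => if e.1.2 = j.1 then 1 else 0) a
  obtain ⟨t, ht, hAt, -⟩ := Int.Matrix.exists_ne_zero_int_vec_norm_le A
    (by simp [Fintype.card_subtype_compl]; omega) (by simp; omega)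
  let c : Fin n × Fin n → ℤ := fun p => if h : p ∈ E then t ⟨p, h⟩ else 0
  have hcE : ∀ p, p ∉ E → c p = 0 := fun p hp => dif_neg hp
  have hct : ∀ e : E, c e = t e := fun e => dif_pos e.2
  have hsum : ∀ g : Fin n × Fin n → ℤ, ∑ p, g p * c p = ∑ e : E, g e * t e := by
    intro g
    rw [← Finset.sum_subset (Finset.subset_univ E) fun p _ hp => by rw [hcE p hp, mul_zero],
      ← Finset.sum_coe_sort]
    exact Finset.sum_congr rfl fun e _ => by rw [hct]
  have hrow : ∀ i, ∑ j, c (i, j) = 0 := by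
    intro i
    have h1 : ∑ e : E, (if e.1.1 = i then 1 else 0) * t e = 0 := congrFun hAt (Sum.inl i)
    rw [← hsum fun p => if p.1 = i then 1 else 0, Fintype.sum_prod_type] at h1
    rw [Finset.sum_eq_single i (fun b _ hb => by simp [hb]) (by simp)] at h1
    simpa using h1
  have hcol : ∀ j, j ≠ j₀ → ∑ i, c (i, j) = 0 := by
    intro j hj
    have h1 : ∑ e : E, (if e.1.2 = j then 1 else 0) * t e = 0 := congrFun hAt (Sum.inr ⟨j, hj⟩)
    rw [← hsum fun p => if p.2 = j then 1 else 0, Fintype.sum_prod_type_right] at h1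
    rw [Finset.sum_eq_single j (fun b _ hb => by simp [hb]) (by simp)] at h1
    simpa using h1
  refine ⟨c, fun h => ht (funext fun e => ?_), hcE, hrow, fun j => ?_⟩
  · rw [← hct, h]; rfl
  by_cases hj : j = j₀
  · have h1 : ∑ j, ∑ i, c (i, j) = 0 := by
      rw [Finset.sum_comm]; exact Finset.sum_eq_zero fun i _ => hrow i
    rw [Finset.sum_eq_single j₀ (fun j _ hj => hcol j hj) (by simp)] at h1
    rw [hj, h1]
  · exact hcol j hj

/-- The binomial `∏ v^{c⁺} - ∏ v^{c⁻}` attached to an integer exponent vector `c`. -/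
def binomial {n : ℕ} (c : Fin n × Fin n → ℤ) (v : Fin n × Fin n → ℂ) : ℂ :=
  ∏ p, v p ^ (c p).toNat - ∏ p, v p ^ (-c p).toNat

theorem binomial_mem_polynomialFunctions {n : ℕ} (c : Fin n × Fin n → ℤ) :
    binomial c ∈ polynomialFunctions (Fin n × Fin n) :=
  fun_sub_mem (fun_prod_mem _ fun p _ => fun_pow_mem (coordinate_mem p) _)
    (fun_prod_mem _ fun p _ => fun_pow_mem (coordinate_mem p) _)

theorem binomial_congr {n : ℕ} {c : Fin n × Fin n → ℤ} {v w : Fin n × Fin n → ℂ}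
    (h : ∀ p, c p ≠ 0 → v p = w p) : binomial c v = binomial c w := by
  have hp : ∀ a : ℤ → ℤ, a 0 = 0 →
      ∏ p, v p ^ (a (c p)).toNat = ∏ p, w p ^ (a (c p)).toNat := by
    intro a ha
    refine Finset.prod_congr rfl fun p _ => ?_
    by_cases hc : c p = 0
    · rw [hc, ha]; simp
    · rw [h p hc]
  exact congrArg₂ (· - ·) (hp id rfl) (hp (fun z => -z) neg_zero)

theorem prod_mul_pow {n : ℕ} (u w : Fin n → ℂ) (a : Fin n × Fin n → ℕ) :
    ∏ p : Fin n × Fin n, (u p.1 * w p.2) ^ a p =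
      (∏ i, u i ^ ∑ j, a (i, j)) * ∏ j, w j ^ ∑ i, a (i, j) := by
  simp only [mul_pow, Finset.prod_mul_distrib]
  rw [Fintype.prod_prod_type, Fintype.prod_prod_type_right]
  simp only [Finset.prod_pow_eq_pow_sum]

theorem sum_toNat_eq {ι : Type*} {s : Finset ι} {c : ι → ℤ} (h : ∑ k ∈ s, c k = 0) :
    ∑ k ∈ s, (c k).toNat = ∑ k ∈ s, (-c k).toNat := by
  zify
  rw [← sub_eq_zero, ← Finset.sum_sub_distrib, ← h]
  exact Finset.sum_congr rfl fun k _ => Int.toNat_sub_toNat_neg _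

/-- Balance gives each `u i` and each `w j` the same exponent in both monomials. -/
theorem binomial_eq_zero {n : ℕ} {c : Fin n × Fin n → ℤ} (hc : IsBalanced c)
    (u w : Fin n → ℂ) : binomial c (fun p => u p.1 * w p.2) = 0 := by
  rw [binomial, prod_mul_pow, prod_mul_pow]
  simp only [sum_toNat_eq (hc.1 _), sum_toNat_eq (hc.2 _), sub_self]

theorem exists_eq_mul_of_rank_le_one {n : ℕ} {A : Matrix (Fin n) (Fin n) ℂ} (h : A.rank ≤ 1) :
    ∃ u w : Fin n → ℂ, ∀ i j, A i j = u i * w j := by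
  rw [rank_eq_finrank_span_cols] at h
  obtain ⟨u, hu⟩ := finrank_le_one_iff.1 h
  choose w hw using fun j => hu ⟨A.col j, Submodule.subset_span ⟨j, rfl⟩⟩
  refine ⟨u, w, fun i j => ?_⟩
  have := congrFun (congrArg Subtype.val (hw j)) i
  simp only [Submodule.coe_smul, Pi.smul_apply, smul_eq_mul, col_apply] at this
  rw [← this, mul_comm]

theorem two_mul_le_card_of_ncard_compl_le {n : ℕ} (hn : 2 ≤ n) (E : Finset (Fin n × Fin n))
    (h : Eᶜ.card ≤ (n - 1) ^ 2 - 1) : 2 * n ≤ E.card := by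
  rw [Finset.card_compl, Fintype.card_prod, Fintype.card_fin] at h
  obtain ⟨m, rfl⟩ := Nat.exists_eq_add_of_le' hn
  have h1 : (m + 2 - 1) ^ 2 - 1 = m * m + 2 * m := by
    rw [show m + 2 - 1 = m + 1 by omega, show (m + 1) ^ 2 = m * m + 2 * m + 1 by ring]
    omega
  have h2 : (m + 2) * (m + 2) = m * m + 2 * m + 2 * (m + 2) := by ring
  omega

/-- The exponents must be fixed before `Y`, so that finitely many binomials serve for all matrices.
-/
theorem exists_isMaximallyBorderRigid_one {n : ℕ} (hn : 2 ≤ n) :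
    ∃ c : Finset (Fin n × Fin n) → Fin n × Fin n → ℤ, (∀ E, c E ≠ 0) ∧
      ∀ Y : Matrix (Fin n) (Fin n) ℂ, (∀ E, binomial (c E) (entries Y) ≠ 0) →
        IsMaximallyBorderRigid 1 Y := by
  have key : ∀ E : Finset (Fin n × Fin n), ∃ c : Fin n × Fin n → ℤ, c ≠ 0 ∧
      (2 * n ≤ E.card → (∀ p, p ∉ E → c p = 0) ∧ IsBalanced c) := by
    intro E
    by_cases h : 2 * n ≤ E.card
    · obtain ⟨c, hc, hc'⟩ := exists_isBalanced (by omega) E h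
      exact ⟨c, hc, fun _ => hc'⟩
    -- Small sets never arise from the locus; any nonzero exponent vector serves as filler.
    · have : Nonempty (Fin n) := ⟨⟨0, by omega⟩⟩
      exact ⟨1, one_ne_zero, fun h' => absurd h' h⟩
  choose c hc0 hc using key
  refine ⟨c, hc0, fun Y hY => ?_⟩
  refine notMem_zariskiClosure (f := fun v => ∏ E, binomial (c E) v)
    (fun_prod_mem _ fun E _ => binomial_mem_polynomialFunctions (c E)) (fun M hM => ?_)
    (Finset.prod_ne_zero_iff.2 fun E _ => hY E)
  obtain ⟨A, hA, hS⟩ := exists_of_rigidity_le hM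
  obtain ⟨u, w, huw⟩ := exists_eq_mul_of_rank_le_one hA
  obtain ⟨E, hE⟩ : ∃ E : Finset (Fin n × Fin n), ∀ p, p ∈ E ↔ M p.1 p.2 = A p.1 p.2 :=
    ⟨Finset.univ.filter fun p => M p.1 p.2 = A p.1 p.2, by simp⟩
  have h1 : {p : Fin n × Fin n | M p.1 p.2 ≠ A p.1 p.2} = ((Eᶜ : Finset _) : Set _) := by
    ext p; simp [hE]
  rw [h1, Set.ncard_coe_finset] at hS
  obtain ⟨hcE, hcb⟩ := hc E (two_mul_le_card_of_ncard_compl_le hn E hS)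
  refine Finset.prod_eq_zero (Finset.mem_univ E) ?_
  rw [← binomial_eq_zero hcb u w]
  refine binomial_congr fun p hp => ?_
  have : p ∈ E := by
    by_contra h
    exact hp (hcE p h)
  rw [← huw]
  exact (hE p).1 this

/-! ### Cauchy matrices -/

/-- Clearing the first column with the first row leaves the smaller Cauchy matrix, with row `i`
scaled by `(x i - x 0) / (x i + z 0)` and column `j` by `(z j - z 0) / (z j + x 0)`. -/
theorem det_cauchy_succ {m : ℕ} (x z : Fin (m + 1) → ℂ) (h : ∀ i j, x i + z j ≠ 0) :
    (cauchy x z).det = 1 / (x 0 + z 0) * (∏ i : Fin m, (x i.succ - x 0) / (x i.succ + z 0)) *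
      (∏ j : Fin m, (z j.succ - z 0) / (z j.succ + x 0)) *
      (cauchy (x ∘ Fin.succ) (z ∘ Fin.succ)).det := by
  let r : Fin (m + 1) → ℂ := Fin.cons 0 fun i => (x 0 + z 0) / (x i.succ + z 0)
  let B : Matrix (Fin (m + 1)) (Fin (m + 1)) ℂ := of fun i j =>
    cauchy x z i j - r i * cauchy x z 0 j
  have hr : r 0 = 0 := rfl
  have hB : (cauchy x z).det = B.det := by
    refine det_eq_of_forall_row_eq_smul_add_const r 0 hr fun i j => ?_
    simp [B, hr]
  have h00 : B 0 0 = 1 / (x 0 + z 0) := by simp [B, hr, cauchy]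
  have hi0 : ∀ i : Fin m, B i.succ 0 = 0 := by
    intro i
    have h1 := h 0 0
    have h2 := h i.succ 0
    simp only [B, r, cauchy, of_apply, Fin.cons_succ]
    field_simp
    ring
  have hsub : B.submatrix Fin.succ Fin.succ = of fun i j : Fin m =>
      ((x i.succ - x 0) / (x i.succ + z 0)) * (of fun i j : Fin m =>
        ((z j.succ - z 0) / (z j.succ + x 0)) *
          cauchy (x ∘ Fin.succ) (z ∘ Fin.succ) i j) i j := by
    ext i j
    have h1 := h 0 0
    have h2 := h i.succ 0
    have h3 := h 0 j.succ
    have h4 := h i.succ j.succ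
    have h5 : z j.succ + x 0 ≠ 0 := by rwa [add_comm]
    simp only [B, r, cauchy, of_apply, Fin.cons_succ, submatrix_apply, Function.comp_apply]
    field_simp
    ring
  rw [hB, det_succ_column_zero, Fin.sum_univ_succ, Finset.sum_eq_zero
    (fun i _ => by rw [hi0]; ring)]
  simp only [Fin.succAbove_zero]
  rw [hsub, det_mul_column, det_mul_row, h00]
  simp only [Fin.val_zero, pow_zero]
  ring

theorem det_cauchy_ne_zero {m : ℕ} {x z : Fin m → ℂ} (h : ∀ i j, x i + z j ≠ 0)
    (hx : Function.Injective x) (hz : Function.Injective z) : (cauchy x z).det ≠ 0 := by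
  induction m with
  | zero => simp
  | succ m ih =>
    rw [det_cauchy_succ x z h]
    refine mul_ne_zero (mul_ne_zero (mul_ne_zero (one_div_ne_zero (h 0 0)) ?_) ?_)
      (ih (fun i j => h _ _) (hx.comp (Fin.succ_injective m)) (hz.comp (Fin.succ_injective m)))
    · exact Finset.prod_ne_zero_iff.2 fun i _ => div_ne_zero
        (sub_ne_zero.2 fun hi => Fin.succ_ne_zero i (hx hi)) (h _ _)
    · exact Finset.prod_ne_zero_iff.2 fun j _ => div_ne_zero
        (sub_ne_zero.2 fun hj => Fin.succ_ne_zero j (hz hj)) (by rw [add_comm]; exact h _ _)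

theorem complMinor_cauchy_ne_zero {n : ℕ} {x z : Fin n → ℂ} (h : ∀ i j, x i + z j ≠ 0)
    (hx : Function.Injective x) (hz : Function.Injective z) (i j : Fin n) :
    complMinor (cauchy x z) {i} {j} ≠ 0 := by
  have hn : 0 < n := i.pos
  obtain ⟨e, he, he'⟩ := exists_enumeration_compl (m := n - 1) {i} (by simp; omega)
  obtain ⟨f, hf, hf'⟩ := exists_enumeration_compl (m := n - 1) {j} (by simp; omega)
  have h1 := complMinor_sq (cauchy x z) he hf he' hf'
  intro h0
  rw [h0, zero_pow two_ne_zero] at h1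
  exact pow_ne_zero 2 (det_cauchy_ne_zero (x := x ∘ e) (z := z ∘ f) (fun _ _ => h _ _)
    (hx.comp he) (hz.comp hf)) h1.symm

/-- All four minors are borderings of the block avoiding the three rows and columns. Peeling the
borders off leaves a common nonzero factor times the expression in `hR`. -/
theorem complMinor_cauchy_relation_ne_zero {n : ℕ} {x z : Fin n → ℂ} (h : ∀ i j, x i + z j ≠ 0)
    (hx : Function.Injective x) (hz : Function.Injective z) (i j : Fin 3 ↪ Fin n)
    (hR : ((x (i 2) - x (i 1)) * (z (j 2) - z (j 1)) *
          ((x (i 2) + z (j 0)) * (z (j 2) + x (i 0)))) ^ 2 -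
        ((x (i 2) - x (i 0)) * (z (j 2) - z (j 0)) *
          ((x (i 2) + z (j 1)) * (z (j 2) + x (i 1)))) ^ 2 ≠ 0) :
    (complMinor (cauchy x z) {i 0} {j 0} * complMinor (cauchy x z) {i 1, i 2} {j 1, j 2}) ^ 2
      - (complMinor (cauchy x z) {i 1} {j 1} *
          complMinor (cauchy x z) {i 0, i 2} {j 0, j 2}) ^ 2 ≠ 0 := by
  have h3 : ∀ g : Fin 3 ↪ Fin n, ({g 0, g 1, g 2} : Finset (Fin n)).card = 3 := by
    intro g
    refine Finset.card_eq_three.2 ⟨_, _, _, ?_, ?_, ?_, rfl⟩ <;> simp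
  have hn : 3 ≤ n := by simpa using Fintype.card_le_of_embedding i
  obtain ⟨e, he, he'⟩ := exists_enumeration_compl (m := n - 3) {i 0, i 1, i 2}
    (by rw [h3]; omega)
  obtain ⟨f, hf, hf'⟩ := exists_enumeration_compl (m := n - 3) {j 0, j 1, j 2}
    (by rw [h3]; omega)
  have hne : ∀ (g : Fin 3 ↪ Fin n) {a b : Fin 3}, a ≠ b → g a ≠ g b :=
    fun g _ _ hab h => hab (g.injective h)
  have hdistinct : ∀ g : Fin 3 ↪ Fin n, g 0 ≠ g 1 ∧ g 0 ≠ g 2 ∧ g 1 ≠ g 2 := fun g =>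
    ⟨hne g (by decide), hne g (by decide), hne g (by decide)⟩
  have cons1 : ∀ (g : Fin 3 ↪ Fin n) {e : Fin (n - 3) → Fin n} (_ : Function.Injective e)
      (_ : ∀ k, k ∈ Set.range e ↔ k ∉ ({g 0, g 1, g 2} : Finset (Fin n))),
      (Function.Injective (Fin.cons (g 0) e : Fin (n - 3 + 1) → Fin n) ∧
        ∀ k, k ∈ Set.range (Fin.cons (g 0) e : Fin (n - 3 + 1) → Fin n) ↔
          k ∉ ({g 1, g 2} : Finset (Fin n))) ∧
      (Function.Injective (Fin.cons (g 1) e : Fin (n - 3 + 1) → Fin n) ∧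
        ∀ k, k ∈ Set.range (Fin.cons (g 1) e : Fin (n - 3 + 1) → Fin n) ↔
          k ∉ ({g 0, g 2} : Finset (Fin n))) ∧
      (Function.Injective (Fin.cons (g 2) e : Fin (n - 3 + 1) → Fin n) ∧
        ∀ k, k ∈ Set.range (Fin.cons (g 2) e : Fin (n - 3 + 1) → Fin n) ↔
          k ∉ ({g 0, g 1} : Finset (Fin n))) := by
    intro g e he he'
    obtain ⟨h01, h02, h12⟩ := hdistinct g
    refine ⟨cons_enumerates he he' (by simp) ?_, cons_enumerates he he' (by simp) ?_,
      cons_enumerates he he' (by simp) ?_⟩ <;>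
      (ext k
       simp only [Finset.mem_insert, Finset.mem_singleton, Finset.mem_erase]
       grind)
  have cons2 : ∀ (g : Fin 3 ↪ Fin n) {e : Fin (n - 3) → Fin n} (_ : Function.Injective e)
      (_ : ∀ k, k ∈ Set.range e ↔ k ∉ ({g 0, g 1, g 2} : Finset (Fin n))),
      (Function.Injective (Fin.cons (g 1) (Fin.cons (g 2) e : Fin (n - 3 + 1) → Fin n) :
          Fin (n - 3 + 1 + 1) → Fin n) ∧
        ∀ k, k ∈ Set.range (Fin.cons (g 1) (Fin.cons (g 2) e : Fin (n - 3 + 1) → Fin n) :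
          Fin (n - 3 + 1 + 1) → Fin n) ↔ k ∉ ({g 0} : Finset (Fin n))) ∧
      (Function.Injective (Fin.cons (g 0) (Fin.cons (g 2) e : Fin (n - 3 + 1) → Fin n) :
          Fin (n - 3 + 1 + 1) → Fin n) ∧
        ∀ k, k ∈ Set.range (Fin.cons (g 0) (Fin.cons (g 2) e : Fin (n - 3 + 1) → Fin n) :
          Fin (n - 3 + 1 + 1) → Fin n) ↔ k ∉ ({g 1} : Finset (Fin n))) := by
    intro g e he he'
    obtain ⟨h01, h02, h12⟩ := hdistinct g
    obtain ⟨h1, h2⟩ := (cons1 g he he').2.2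
    refine ⟨cons_enumerates h1 h2 (by simp) ?_, cons_enumerates h1 h2 (by simp) ?_⟩ <;>
      (ext k
       simp only [Finset.mem_insert, Finset.mem_singleton, Finset.mem_erase]
       grind)
  set D := (cauchy (x ∘ e) (z ∘ f)).det with hD
  have hD0 : D ≠ 0 := det_cauchy_ne_zero (fun _ _ => h _ _) (hx.comp he) (hz.comp hf)
  -- The factor gained by bordering the common block with row `i a` and column `j a`.
  let q : Fin 3 → ℂ := fun a => 1 / (x (i a) + z (j a)) *
    (∏ k, (x (e k) - x (i a)) / (x (e k) + z (j a))) *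
    (∏ k, (z (f k) - z (j a)) / (z (f k) + x (i a)))
  have hq : ∀ a, q a ≠ 0 := by
    intro a
    have hia : ∀ b, i a ∈ ({i 0, i 1, i 2} : Finset (Fin n)) → e b ≠ i a :=
      fun b hm hb => (he' (i a)).1 ⟨b, hb⟩ hm
    have hja : ∀ b, j a ∈ ({j 0, j 1, j 2} : Finset (Fin n)) → f b ≠ j a :=
      fun b hm hb => (hf' (j a)).1 ⟨b, hb⟩ hm
    have hmem : ∀ g : Fin 3 ↪ Fin n, g a ∈ ({g 0, g 1, g 2} : Finset (Fin n)) := by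
      intro g; fin_cases a <;> simp
    refine mul_ne_zero (mul_ne_zero (one_div_ne_zero (h _ _)) ?_) ?_
    · exact Finset.prod_ne_zero_iff.2 fun k _ => div_ne_zero
        (sub_ne_zero.2 fun hk => hia k (hmem i) (hx hk)) (h _ _)
    · exact Finset.prod_ne_zero_iff.2 fun k _ => div_ne_zero
        (sub_ne_zero.2 fun hk => hja k (hmem j) (hz hk)) (by rw [add_comm]; exact h _ _)
  have d1 : ∀ a, ((cauchy x z).submatrix (Fin.cons (i a) e : Fin (n - 3 + 1) → Fin n)
      (Fin.cons (j a) f : Fin (n - 3 + 1) → Fin n)).det = q a * D := fun a =>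
    det_cauchy_succ (x ∘ (Fin.cons (i a) e : Fin (n - 3 + 1) → Fin n))
      (z ∘ (Fin.cons (j a) f : Fin (n - 3 + 1) → Fin n)) fun _ _ => h _ _
  -- A double bordering gains `q a * q 2` and one interaction factor between the two borders.
  have d2 : ∀ a, ((cauchy x z).submatrix
      (Fin.cons (i a) (Fin.cons (i 2) e : Fin (n - 3 + 1) → Fin n) : Fin (n - 3 + 1 + 1) → Fin n)
      (Fin.cons (j a) (Fin.cons (j 2) f : Fin (n - 3 + 1) → Fin n) :
        Fin (n - 3 + 1 + 1) → Fin n)).det =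
      ((x (i 2) - x (i a)) / (x (i 2) + z (j a)) * ((z (j 2) - z (j a)) / (z (j 2) + x (i a))))
        * (q a * (q 2 * D)) := by
    intro a
    refine (det_cauchy_succ
      (x ∘ (Fin.cons (i a) (Fin.cons (i 2) e : Fin (n - 3 + 1) → Fin n) :
        Fin (n - 3 + 1 + 1) → Fin n))
      (z ∘ (Fin.cons (j a) (Fin.cons (j 2) f : Fin (n - 3 + 1) → Fin n) :
        Fin (n - 3 + 1 + 1) → Fin n)) fun _ _ => h _ _).trans ?_
    have h2 : (cauchy ((x ∘ (Fin.cons (i a) (Fin.cons (i 2) e : Fin (n - 3 + 1) → Fin n) :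
        Fin (n - 3 + 1 + 1) → Fin n)) ∘ Fin.succ)
      ((z ∘ (Fin.cons (j a) (Fin.cons (j 2) f : Fin (n - 3 + 1) → Fin n) :
        Fin (n - 3 + 1 + 1) → Fin n)) ∘ Fin.succ)).det = q 2 * D := d1 2
    rw [h2]
    simp only [Fin.prod_univ_succ, Function.comp_apply, Fin.cons_succ, Fin.cons_zero, q]
    ring
  obtain ⟨ci0, ci1, -⟩ := cons1 i he he'
  obtain ⟨cj0, cj1, -⟩ := cons1 j hf hf'
  obtain ⟨ci21, ci20⟩ := cons2 i he he'
  obtain ⟨cj21, cj20⟩ := cons2 j hf hf'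
  rw [mul_pow, mul_pow, complMinor_sq _ ci0.1 cj0.1 ci0.2 cj0.2,
    complMinor_sq _ ci1.1 cj1.1 ci1.2 cj1.2, complMinor_sq _ ci21.1 cj21.1 ci21.2 cj21.2,
    complMinor_sq _ ci20.1 cj20.1 ci20.2 cj20.2, d1, d1, d2, d2]
  have k1 := h (i 2) (j 1)
  have k2 := h (i 2) (j 0)
  have k3 : z (j 2) + x (i 1) ≠ 0 := by rw [add_comm]; exact h _ _
  have k4 : z (j 2) + x (i 0) ≠ 0 := by rw [add_comm]; exact h _ _
  have hfac : (q 0 * q 1 * q 2 * D ^ 2 / ((x (i 2) + z (j 1)) * (z (j 2) + x (i 1)) *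
      ((x (i 2) + z (j 0)) * (z (j 2) + x (i 0))))) ^ 2 ≠ 0 :=
    pow_ne_zero 2 (div_ne_zero (mul_ne_zero (mul_ne_zero (mul_ne_zero (hq 0) (hq 1)) (hq 2))
      (pow_ne_zero 2 hD0)) (mul_ne_zero (mul_ne_zero k1 k3) (mul_ne_zero k2 k4)))
  convert mul_ne_zero hfac hR using 1
  field_simp

/-! ### Generic pairs of vectors -/

/-- The point with `x i₀ = -1`, `z j₀ = 1` and all other `x` equal to `2`, all other `z` equal to
`3`, at which `x i + z j` vanishes only for `(i, j) = (i₀, j₀)`. -/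
noncomputable def separatingPoint {n : ℕ} (i₀ j₀ : Fin n) : Fin n ⊕ Fin n → ℂ :=
  Sum.elim (fun i => if i = i₀ then -1 else 2) (fun j => if j = j₀ then 1 else 3)

theorem separatingPoint_add_eq_zero_iff {n : ℕ} {i₀ j₀ i j : Fin n} :
    separatingPoint i₀ j₀ (Sum.inl i) + separatingPoint i₀ j₀ (Sum.inr j) = 0 ↔
      i = i₀ ∧ j = j₀ := by
  by_cases hi : i = i₀ <;> by_cases hj : j = j₀ <;> norm_num [separatingPoint, hi, hj]

theorem add_mem_polynomialFunctions {n : ℕ} (i j : Fin n) :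
    (fun v : Fin n ⊕ Fin n → ℂ => v (Sum.inl i) + v (Sum.inr j)) ∈
      polynomialFunctions (Fin n ⊕ Fin n) :=
  fun_add_mem (coordinate_mem _) (coordinate_mem _)

theorem holdsGenerically_add_ne_zero {n : ℕ} (i j : Fin n) :
    HoldsGenerically fun v : Fin n ⊕ Fin n → ℂ => v (Sum.inl i) + v (Sum.inr j) ≠ 0 :=
  holdsGenerically_ne_zero (add_mem_polynomialFunctions i j) 1 (by norm_num)

theorem holdsGenerically_coordinate_ne {ι : Type*} {a b : ι} (hab : a ≠ b) :
    HoldsGenerically fun v : ι → ℂ => v a - v b ≠ 0 := by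
  classical
  exact holdsGenerically_ne_zero (fun_sub_mem (coordinate_mem a) (coordinate_mem b))
    (Pi.single a 1) (by simp [hab.symm])

/-- Where only `x (i a) + z (j a)` vanishes, with `σ a ≠ a`, the first product is zero and the
second is not. -/
theorem holdsGenerically_cycle {n k : ℕ} (i j : Fin k ↪ Fin n) {σ : Equiv.Perm (Fin k)}
    (hσ : σ ≠ 1) : HoldsGenerically fun v : Fin n ⊕ Fin n → ℂ =>
      ∏ a, (v (Sum.inl (i a)) + v (Sum.inr (j a)))
        - ∏ a, (v (Sum.inl (i a)) + v (Sum.inr (j (σ a)))) ≠ 0 := by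
  obtain ⟨a, ha⟩ : ∃ a, σ a ≠ a := by
    by_contra! h
    exact hσ (Equiv.ext h)
  refine holdsGenerically_ne_zero (fun_sub_mem
    (fun_prod_mem _ fun a _ => add_mem_polynomialFunctions _ _)
    (fun_prod_mem _ fun a _ => add_mem_polynomialFunctions _ _)) (separatingPoint (i a) (j a)) ?_
  rw [Finset.prod_eq_zero (Finset.mem_univ a) (separatingPoint_add_eq_zero_iff.2 ⟨rfl, rfl⟩),
    zero_sub, neg_ne_zero, Finset.prod_ne_zero_iff]
  intro b _ hb
  obtain ⟨hi, hj⟩ := separatingPoint_add_eq_zero_iff.1 hb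
  obtain rfl := i.injective hi
  exact ha (j.injective hj)

/-- The two monomials share no variable; killing one that occurs leaves exactly one monomial
nonzero. -/
theorem holdsGenerically_binomial {n : ℕ} {c : Fin n × Fin n → ℤ} (hc : c ≠ 0) :
    HoldsGenerically fun v : Fin n ⊕ Fin n → ℂ =>
      binomial c (fun p => v (Sum.inl p.1) + v (Sum.inr p.2)) ≠ 0 := by
  obtain ⟨p, hp⟩ := Function.ne_iff.1 hc
  refine holdsGenerically_ne_zero (fun_sub_mem
    (fun_prod_mem _ fun _ _ => fun_pow_mem (add_mem_polynomialFunctions _ _) _)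
    (fun_prod_mem _ fun _ _ => fun_pow_mem (add_mem_polynomialFunctions _ _) _))
    (separatingPoint p.1 p.2) ?_
  have hzero : ∀ a : Fin n × Fin n → ℕ, a p ≠ 0 → ∏ q : Fin n × Fin n,
      (separatingPoint p.1 p.2 (Sum.inl q.1) + separatingPoint p.1 p.2 (Sum.inr q.2)) ^ a q = 0 :=
    fun a ha => Finset.prod_eq_zero (Finset.mem_univ p)
      (by rw [separatingPoint_add_eq_zero_iff.2 ⟨rfl, rfl⟩, zero_pow ha])
  have hne : ∀ a : Fin n × Fin n → ℕ, a p = 0 → ∏ q : Fin n × Fin n,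
      (separatingPoint p.1 p.2 (Sum.inl q.1) + separatingPoint p.1 p.2 (Sum.inr q.2)) ^ a q ≠ 0 := by
    intro a ha
    refine Finset.prod_ne_zero_iff.2 fun q _ => ?_
    by_cases hq : q = p
    · rw [hq, ha, pow_zero]; exact one_ne_zero
    · exact pow_ne_zero _ fun h => hq (Prod.ext_iff.2 (separatingPoint_add_eq_zero_iff.1 h))
  rcases lt_or_gt_of_ne hp with h | h
  · have h' : c p < 0 := h
    rw [binomial, hzero (fun q => (-c q).toNat) (by omega), sub_zero]
    exact hne (fun q => (c q).toNat) (by omega)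
  · have h' : 0 < c p := h
    rw [binomial, hzero (fun q => (c q).toNat) (by omega), zero_sub, neg_ne_zero]
    exact hne (fun q => (-c q).toNat) (by omega)

theorem holdsGenerically_complMinor_relation {n : ℕ} (i j : Fin 3 ↪ Fin n) :
    HoldsGenerically fun v : Fin n ⊕ Fin n → ℂ =>
      ((v (Sum.inl (i 2)) - v (Sum.inl (i 1))) * (v (Sum.inr (j 2)) - v (Sum.inr (j 1))) *
          ((v (Sum.inl (i 2)) + v (Sum.inr (j 0))) *
            (v (Sum.inr (j 2)) + v (Sum.inl (i 0))))) ^ 2 -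
        ((v (Sum.inl (i 2)) - v (Sum.inl (i 0))) * (v (Sum.inr (j 2)) - v (Sum.inr (j 0))) *
          ((v (Sum.inl (i 2)) + v (Sum.inr (j 1))) *
            (v (Sum.inr (j 2)) + v (Sum.inl (i 1))))) ^ 2 ≠ 0 := by
  have hx : ∀ k, (fun v : Fin n ⊕ Fin n → ℂ => v k) ∈ polynomialFunctions (Fin n ⊕ Fin n) :=
    coordinate_mem
  refine holdsGenerically_ne_zero (fun_sub_mem
    (fun_pow_mem (fun_mul_mem (fun_mul_mem (fun_sub_mem (hx _) (hx _)) (fun_sub_mem (hx _) (hx _)))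
      (fun_mul_mem (fun_add_mem (hx _) (hx _)) (fun_add_mem (hx _) (hx _)))) _)
    (fun_pow_mem (fun_mul_mem (fun_mul_mem (fun_sub_mem (hx _) (hx _)) (fun_sub_mem (hx _) (hx _)))
      (fun_mul_mem (fun_add_mem (hx _) (hx _)) (fun_add_mem (hx _) (hx _)))) _))
    -- Here `x (i 2) = x (i 1)` kills the first square, while the second equals `1`.
    (Sum.elim (fun k => if k = i 0 then 1 else 0) (fun k => if k = j 0 then 0 else 1)) ?_
  simp

theorem entries_cauchy {n : ℕ} (x z : Fin n → ℂ) :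
    entries (cauchy x z) = fun p => (x p.1 + z p.2)⁻¹ := by
  ext p; simp [entries, cauchy]

theorem binomial_inv_ne_zero {n : ℕ} {c : Fin n × Fin n → ℤ} {v : Fin n × Fin n → ℂ}
    (h : binomial c v ≠ 0) : binomial c (fun p => (v p)⁻¹) ≠ 0 := by
  simp only [binomial, inv_pow, Finset.prod_inv_distrib, sub_ne_zero] at h ⊢
  exact fun h' => h (inv_injective h')

theorem rigidity_cauchy_le {n : ℕ} {x z : Fin n → ℂ} (h : ∀ i j, x i + z j ≠ 0)
    (hx : Function.Injective x) (hz : Function.Injective z) {r : ℕ} (hr : r ≤ n) :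
    rigidity r (cauchy x z) ≤ (n - r) ^ 2 :=
  rigidity_le_of_det_ne_zero (Fin.castLEEmb hr) (Fin.castLEEmb hr)
    (det_cauchy_ne_zero (x := x ∘ Fin.castLEEmb hr) (z := z ∘ Fin.castLEEmb hr)
      (fun _ _ => h _ _) (hx.comp (Fin.castLEEmb hr).injective)
      (hz.comp (Fin.castLEEmb hr).injective))

end MatrixRigidity

theorem mainTheorem10 (n : ℕ) (hn : 2 ≤ n) :
    ∃ F : MvPolynomial (Fin n ⊕ Fin n) ℂ, F ≠ 0 ∧
      ∀ x z : Fin n → ℂ, MvPolynomial.eval (Sum.elim x z) F ≠ 0 →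
        (∀ i j, x i + z j ≠ 0) ∧
        MatrixRigidity.IsMaximallyRigid 1 (MatrixRigidity.cauchy x z) ∧
        MatrixRigidity.IsMaximallyBorderRigid 1 (MatrixRigidity.cauchy x z) ∧
        MatrixRigidity.IsMaximallyRigid (n - 2) (MatrixRigidity.cauchy x z) ∧
        MatrixRigidity.IsMaximallyBorderRigid (n - 2) (MatrixRigidity.cauchy x z) ∧
        (∀ (k : ℕ) (i j : Fin k ↪ Fin n) (σ : Equiv.Perm (Fin k)),
          σ.IsCycle → σ.support = Finset.univ →
          ∏ a, MatrixRigidity.cauchy x z (i a) (j a)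
            - ∏ a, MatrixRigidity.cauchy x z (i a) (j (σ a)) ≠ 0) ∧
        (∀ i j : Fin n, MatrixRigidity.complMinor (MatrixRigidity.cauchy x z) {i} {j} ≠ 0) ∧
        (∀ i j : Fin 3 ↪ Fin n,
          MatrixRigidity.complMinor (MatrixRigidity.cauchy x z) {i 0} {j 0}
              * MatrixRigidity.complMinor (MatrixRigidity.cauchy x z) {i 1, i 2} {j 1, j 2}
            - MatrixRigidity.complMinor (MatrixRigidity.cauchy x z) {i 1} {j 1}
              * MatrixRigidity.complMinor (MatrixRigidity.cauchy x z) {i 0, i 2} {j 0, j 2}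
              ≠ 0) := by
  open MatrixRigidity in
  obtain ⟨c, hc, hborder⟩ := exists_isMaximallyBorderRigid_one hn
  obtain ⟨F, hF, hgen⟩ :=
    (HoldsGenerically.forall fun i : Fin n => .forall fun j : Fin n =>
      holdsGenerically_add_ne_zero i j).and <|
    (HoldsGenerically.forall fun p : {p : Fin n × Fin n // p.1 ≠ p.2} =>
      (holdsGenerically_coordinate_ne (Sum.inl_injective.ne p.2 :
        (Sum.inl p.1.1 : Fin n ⊕ Fin n) ≠ Sum.inl p.1.2)).and
      (holdsGenerically_coordinate_ne (Sum.inr_injective.ne p.2 :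
        (Sum.inr p.1.1 : Fin n ⊕ Fin n) ≠ Sum.inr p.1.2))).and <|
    -- An injection `Fin k ↪ Fin n` forces `k ≤ n`, so the family of cycle conditions is finite.
    (HoldsGenerically.forall fun k : Fin (n + 1) => .forall fun i : Fin k ↪ Fin n =>
      .forall fun j : Fin k ↪ Fin n => .forall fun σ : {σ : Equiv.Perm (Fin k) // σ ≠ 1} =>
        holdsGenerically_cycle i j σ.2).and <|
    (HoldsGenerically.forall fun E => holdsGenerically_binomial (hc E)).and <|
    (HoldsGenerically.forall fun i : Fin 3 ↪ Fin n => .forall fun j : Fin 3 ↪ Fin n =>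
      holdsGenerically_complMinor_relation i j)
  refine ⟨F, hF, fun x z hxz => ?_⟩
  obtain ⟨h, hinj, hcycle, hbin, hrel⟩ := hgen _ hxz
  simp only [Sum.elim_inl, Sum.elim_inr] at h hinj hcycle hbin hrel
  have hx : Function.Injective x := fun a b hab => by
    by_contra hne
    exact (hinj ⟨(a, b), hne⟩).1 (sub_eq_zero.2 hab)
  have hz : Function.Injective z := fun a b hab => by
    by_contra hne
    exact (hinj ⟨(a, b), hne⟩).2 (sub_eq_zero.2 hab)
  have hminor := complMinor_cauchy_ne_zero h hx hz
  have hminors := fun i j : Fin 3 ↪ Fin n =>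
    complMinor_cauchy_relation_ne_zero h hx hz i j (hrel i j)
  have hb1 : IsMaximallyBorderRigid 1 (cauchy x z) := hborder _ fun E => by
    rw [entries_cauchy]
    exact binomial_inv_ne_zero (hbin E)
  have hb2 : IsMaximallyBorderRigid (n - 2) (cauchy x z) :=
    isMaximallyBorderRigid_sub_two hn hminor hminors
  refine ⟨h, isMaximallyRigid_of_borderRigid hb1 (rigidity_cauchy_le h hx hz (by omega)), hb1,
    isMaximallyRigid_of_borderRigid hb2 (rigidity_cauchy_le h hx hz (by omega)), hb2,
    fun k i j σ hσ _ => ?_, hminor, fun i j h0 => hminors i j ?_⟩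
  · have hk : k < n + 1 := Nat.lt_succ_of_le (by simpa using Fintype.card_le_of_embedding i)
    have := hcycle ⟨k, hk⟩ i j ⟨σ, hσ.ne_one⟩
    rw [sub_ne_zero] at this ⊢
    simp only [cauchy, Matrix.of_apply, one_div, Finset.prod_inv_distrib]
    exact fun h' => this (inv_injective h')
  -- Equality of the two products would give equality of their squares, which is excluded.
  · rw [sub_eq_zero] at h0 ⊢
    rw [h0]
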